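/- All graphs are simple, and the vertex set of a connected graph carries its path metric. A function $[0,\infty)\to[0,\infty)$ is proper if it tends to $\infty$ at $\infty$. A sequence of metric spaces $(X_n,d_n)_{n\in\mathbb N}$ coarsely embeds into a Hilbert space if there are a real Hilbert space $\mathcal H$, maps $\phi_n\colon X_n\to\mathcal H$ and proper functions $\rho,\gamma\colon[0,\infty)\to[0,\infty)$, independent of $n$, such that $\rho(d_n(x,y))\le\|\phi_n(x)-\phi_n(y)\|\le\gamma(d_n(x,y))$ for all $n$ and all $x,y\in X_n$. An expander is a sequence $(X_n)_{n\in\mathbb N}$ of finite connected graphs with uniformly bounded degree and $|X_n|\to\infty$ such that, for some $\varepsilon>0$, $|\partial A|\ge\varepsilon|A|$ for all $n$ and all $A\subseteq X_n$ with $1\le|A|\le|X_n|/2$, where $\partial A$ is the set of edges between $A$ and its complement. For a group $G$ generated by a set $S$, $d_S$ denotes the word metric, that is, the path metric of the Cayley graph in which $g$ and $gs$ are joined by an edge for all $g\in G$, $s\in S$ with $gs\ne g$. **Proposition.** Let $(G_n)_{n\in\mathbb N}$ be a sequence of groups equipped with finite generating sets $S_n$ of size $k$, with $k$ independent of $n$.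 Assume that for every $n$ there is an exact sequence $$1\to N_n\to G_n\to Q_n\to 1$$ such that - the sequence $(N_n)_{n\in\mathbb N}$, equipped with the metric induced by $d_{S_n}$, coarsely embeds into a Hilbert space; - the sequence $(Q_n)_{n\in\mathbb N}$, equipped with the word metric $d_{T_n}$ associated to the image $T_n$ of $S_n$ in $Q_n$, coarsely embeds into a Hilbert space. Let $K>0$, let $(X_n)_{n\in\mathbb N}$ be an expander, and let $h_n\colon X_n\to(G_n,d_{S_n})$ be a sequence of $K$-Lipschitz maps. Then there exist a constant $c>0$ and a sequence $y_n\in G_n$ such that the cardinality of $h_n^{-1}(\{y_n\})$ is at least $c|X_n|$ for every $n$, and the diameter of $h_n^{-1}(\{y_n\})$ in $X_n$ is at least $c\,\mathrm{diam}(X_n)$ for all sufficiently large $n$. -/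

import Mathlib

open Filter
open scoped NNReal ENNReal

/-- The word metric on a group `G` for a generating set `S`: the path metric of the Cayley graph of
`(G, S)`, in which `g` and `g * s` are joined by an edge for `s ∈ S`. -/
noncomputable def wordDist {G : Type*} [Group G] (S : Set G) (g h : G) : ℕ :=
  (SimpleGraph.mulCayley S).dist g h

/-- A sequence of maps `φ n` from sets `X n` with distance functions `d n` to a metric space `Y` is
a coarse embedding of the sequence if two proper control functions `ρ, γ : [0, ∞) → [0, ∞)`, the
same for all `n`, bound the distances of images from below and above. A function
`[0, ∞) → [0, ∞)` is proper if it tends to infinity at infinity. -/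
def IsCoarseEmbeddingSeq {X : ℕ → Type*} (d : ∀ n, X n → X n → ℝ≥0)
    {Y : Type*} [MetricSpace Y] (φ : ∀ n, X n → Y) : Prop :=
  ∃ ρ γ : ℝ≥0 → ℝ≥0, Tendsto ρ atTop atTop ∧ Tendsto γ atTop atTop ∧
    ∀ (n : ℕ) (x y : X n),
      ρ (d n x y) ≤ nndist (φ n x) (φ n y) ∧ nndist (φ n x) (φ n y) ≤ γ (d n x y)

open scoped Classical in
/-- The Cheeger constant of a finite graph: the minimum of `|∂A| / |A|` over the vertex sets `A`
with `1 ≤ |A| ≤ |X| / 2`, where `∂A` is the set of edges between `A` and its complement (and `∞`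
for a graph with one vertex, where there is no such `A`). -/
noncomputable def cheegerConstant {V : Type*} [Fintype V] (X : SimpleGraph V) : ℝ≥0∞ :=
  ⨅ A : {A : Finset V // 1 ≤ A.card ∧ 2 * A.card ≤ Fintype.card V},
    ((X.interedges A.1 A.1ᶜ).card : ℝ≥0∞) / (A.1.card : ℝ≥0∞)

/-- An expander: a sequence of finite connected graphs of uniformly bounded degree, whose numbers
of vertices tend to infinity and whose Cheeger constants are bounded below by some `c > 0`. -/
structure IsExpander {V : ℕ → Type*} [∀ n, Fintype (V n)] (X : ∀ n, SimpleGraph (V n)) :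
    Prop where
  connected : ∀ n, (X n).Connected
  degree_bounded : ∃ D : ℕ, ∀ (n : ℕ) (v : V n), ((X n).neighborSet v).ncard ≤ D
  card_tendsto : Tendsto (fun n => Fintype.card (V n)) atTop atTop
  cheeger_bounded_below : ∃ c : ℝ≥0, 0 < c ∧ ∀ n, (c : ℝ≥0∞) ≤ cheegerConstant (X n)

/-- The diameter of a set `A` of vertices of a graph `X`, for the path metric of `X`
(used for sets of vertices of finite connected graphs only). -/
noncomputable def graphSetDiam {V : Type*} (X : SimpleGraph V) (A : Set V) : ℕ :=
  sSup {k : ℕ | ∃ x ∈ A, ∃ y ∈ A, X.dist x y = k}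

/-!
The maps `h n` have a large fiber because expanders admit no spread-out map to a Hilbert space,
even when the map is only defined on a definite proportion of the vertices. This concentration
principle, `exists_concentration`, is applied twice. Composed with the projections `G n → Q n`, the
`h n` are Lipschitz for the word metrics of the quotients, which embed coarsely; so a definite
proportion of `X n` is sent to a ball of bounded radius of `Q n`, hence, balls of bounded radius
being of bounded size, a definite proportion `A n` is sent to one point. The set `A n` is mapped by
`h n` to a coset of `N n`, which embeds coarsely by left invariance of the word metric of `G n`; so
the same reasoning, applied to `A n`, gives a fiber of `h n` containing a definite proportion of
`X n` (`IsExpander.exists_large_fiber` is one round of this argument).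

For the concentration principle, the isoperimetric inequality gives, through the co-area inequality
and a median, the Poincaré inequality `sum_sum_sub_sq_le`, which passes to positive semidefinite
kernels. On the proportion `A` where a map `f` to a Hilbert space is given, the difficulty is that
`‖f x - f y‖` is controlled by the distance in the ambient graph through an arbitrary function `γ`,
so that `f` has no extension of bounded energy. It does after passing to the bounded kernel
`exp (-t ‖f x - f y‖²)`: with `p x` a point of `A` nearest to `x` and `w` a cut-off function which
is `1` on `A` and vanishes at distance `R` from it, the kernel
`w x * w y * exp (-t ‖f (p x) - f (p y)‖²)` has energy per edge as small as desired, for `R` large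
and then `t` small. By the Poincaré inequality, the kernel is then on average close to `1` on
`A × A`, which bounds `‖f x - f y‖` for a definite proportion of the pairs.

The statement about diameters follows from that about cardinalities: a set with a definite
proportion of the vertices has diameter at least of the order of `log |X n|`, by the bound on the
degree, while the diameter of an expander is at most of that order, by the exponential growth of
balls.
-/

/-! ### The Poincaré inequality of an expander -/

section Poincare
open scoped Classical
open Finset

variable {V : Type*} [Fintype V] {X : SimpleGraph V} {c : ℝ} {D : ℕ}

theorem mul_card_le_card_interedges_of_le_cheegerConstant {c : ℝ≥0}
    (hc : (c : ℝ≥0∞) ≤ cheegerConstant X) (A : Finset V) (hA : 2 * #A ≤ Fintype.card V) :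
    (c : ℝ) * #A ≤ #(X.interedges A Aᶜ) := by
  rcases A.eq_empty_or_nonempty with rfl | hne
  · simp
  have h1 : 1 ≤ #A := hne.card_pos
  have h2 := hc.trans (iInf_le _ (⟨A, h1, hA⟩ : {A : Finset V // 1 ≤ #A ∧ 2 * #A ≤ _}))
  rw [ENNReal.le_div_iff_mul_le (by left; simpa using hne.ne_empty) (by left; simp)] at h2
  exact_mod_cast h2

theorem sum_interedges_univ_swap (F : V × V → ℝ) :
    ∑ e ∈ X.interedges univ univ, F e.swap = ∑ e ∈ X.interedges univ univ, F e := by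
  refine Finset.sum_nbij' Prod.swap Prod.swap ?_ ?_ ?_ ?_ ?_ <;>
    simp [SimpleGraph.mem_interedges_iff, SimpleGraph.adj_comm]

theorem sum_interedges_univ_fst_le (hD : ∀ v, (X.neighborSet v).ncard ≤ D) {F : V → ℝ}
    (hF : ∀ v, 0 ≤ F v) :
    ∑ e ∈ X.interedges univ univ, F e.1 ≤ D * ∑ v, F v := by
  have h1 : ∑ e ∈ X.interedges univ univ, F e.1 = ∑ v, ((X.neighborSet v).ncard : ℝ) * F v := by
    rw [SimpleGraph.interedges_def, Finset.sum_filter, Finset.sum_product]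
    refine Finset.sum_congr rfl fun v _ => ?_
    rw [← Finset.sum_filter]
    dsimp only
    rw [Finset.sum_const, nsmul_eq_mul, Set.ncard_eq_toFinset_card']
    congr 3
    ext w; simp
  rw [h1, Finset.mul_sum]
  gcongr with v
  · exact hF v
  · exact hD v

/-- The discrete co-area inequality: integrating the isoperimetric inequality over the superlevel
sets of `g`. The proof peels off the lowest level set of `g` at a time. -/
theorem mul_sum_le_sum_interedges_abs_sub
    (hX : ∀ A : Finset V, 2 * #A ≤ Fintype.card V → c * #A ≤ #(X.interedges A Aᶜ))
    (g : V → ℝ) (hg : ∀ v, 0 ≤ g v) (hsupp : 2 * #{v | g v ≠ 0} ≤ Fintype.card V) :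
    c * ∑ v, g v ≤ ∑ e ∈ X.interedges univ univ, |g e.1 - g e.2| := by
  induction hn : #{v | g v ≠ 0} using Nat.strong_induction_on generalizing g with
  | _ n ih =>
  subst hn
  set A : Finset V := {v | g v ≠ 0} with hAdef
  have hmem : ∀ v, v ∈ A ↔ g v ≠ 0 := by simp [hAdef]
  rcases A.eq_empty_or_nonempty with hA | hA
  · have : ∀ v, g v = 0 := fun v => by
      by_contra h
      have := (hmem v).2 h
      simp [hA] at this
    simp [this]
  obtain ⟨a, haA, hmin⟩ := A.exists_min_image g hA
  have ha : 0 < g a := lt_of_le_of_ne (hg a) (Ne.symm ((hmem a).1 haA))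
  let g' : V → ℝ := fun v => if v ∈ A then g v - g a else 0
  have hg' : ∀ v, 0 ≤ g' v := fun v => by
    simp only [g']
    split_ifs with hv
    · exact sub_nonneg.2 (hmin v hv)
    · exact le_rfl
  have hss : ({v | g' v ≠ 0} : Finset V) ⊂ A := by
    refine Finset.ssubset_iff_subset_ne.2 ⟨fun v hv => ?_, fun h => ?_⟩
    · by_contra h
      simp [g', h] at hv
    · rw [← h] at haA
      simp [g'] at haA
  have hlt := Finset.card_lt_card hss
  have key := ih _ hlt g' hg' (by omega) rfl
  have hsum : ∑ v, g v = ∑ v, g' v + #A * g a := by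
    have : ∀ v, g v = g' v + if v ∈ A then g a else 0 := fun v => by
      simp only [g']
      split_ifs with hv
      · ring
      · have := (hmem v).not.1 hv
        push Not at this
        simp [this]
    rw [Finset.sum_congr rfl fun v _ => this v, Finset.sum_add_distrib]
    simp
  have hedge : ∑ e ∈ X.interedges univ univ, |g' e.1 - g' e.2| + #(X.interedges A Aᶜ) * g a
      ≤ ∑ e ∈ X.interedges univ univ, |g e.1 - g e.2| := by
    have h1 : (#(X.interedges A Aᶜ) : ℝ) * g a
        = ∑ e ∈ X.interedges univ univ, if e.1 ∈ A ∧ e.2 ∉ A then g a else 0 := by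
      rw [← Finset.sum_filter, Finset.sum_const, nsmul_eq_mul]
      congr 3
      ext e
      simp [SimpleGraph.mem_interedges_iff]
      tauto
    rw [h1, ← Finset.sum_add_distrib]
    refine Finset.sum_le_sum fun e _ => ?_
    have h0 : ∀ v, v ∉ A → g v = 0 := fun v hv => by
      have := (hmem v).not.1 hv
      push Not at this
      exact this
    by_cases h1 : e.1 ∈ A <;> by_cases h2 : e.2 ∈ A
    · simp [g', h1, h2]
    · have := hmin _ h1
      simp only [g', h1, h2, h0 _ h2, if_true, if_false, sub_zero, not_false_iff, and_self]
      rw [abs_of_nonneg (by linarith), abs_of_nonneg (hg _)]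
      linarith
    · have := hmin _ h2
      simp only [g', h1, h2, h0 _ h1, if_true, if_false, zero_sub, abs_neg, not_true, and_self]
      rw [abs_of_nonneg (by linarith), abs_of_nonneg (hg _)]
      simp
      linarith
    · simp [g', h1, h2, h0 _ h1, h0 _ h2]
  have hAc := mul_le_mul_of_nonneg_right (hX A hsupp) ha.le
  rw [hsum]
  linarith

/-- The `L²` inequality for functions supported on at most half of the vertices, obtained from the
co-area inequality for `g²` and the Cauchy-Schwarz inequality. -/
theorem sq_mul_sum_sq_le_of_small_support (hc : 0 ≤ c)
    (hX : ∀ A : Finset V, 2 * #A ≤ Fintype.card V → c * #A ≤ #(X.interedges A Aᶜ))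
    (hD : ∀ v, (X.neighborSet v).ncard ≤ D)
    (g : V → ℝ) (hg : ∀ v, 0 ≤ g v) (hsupp : 2 * #{v | g v ≠ 0} ≤ Fintype.card V) :
    c ^ 2 * ∑ v, g v ^ 2 ≤ 4 * D * ∑ e ∈ X.interedges univ univ, (g e.1 - g e.2) ^ 2 := by
  set s := ∑ v, g v ^ 2
  set E := ∑ e ∈ X.interedges univ univ, (g e.1 - g e.2) ^ 2
  have hs : 0 ≤ s := Finset.sum_nonneg fun v _ => sq_nonneg _
  have hE : 0 ≤ E := Finset.sum_nonneg fun v _ => sq_nonneg _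
  have h1 : c * s ≤ ∑ e ∈ X.interedges univ univ, |g e.1 - g e.2| * (g e.1 + g e.2) := by
    refine (mul_sum_le_sum_interedges_abs_sub hX (fun v => g v ^ 2) (fun v => sq_nonneg _)
      (by simpa using hsupp)).trans_eq (Finset.sum_congr rfl fun e _ => ?_)
    rw [show g e.1 ^ 2 - g e.2 ^ 2 = (g e.1 - g e.2) * (g e.1 + g e.2) by ring, abs_mul,
      abs_of_nonneg (add_nonneg (hg e.1) (hg e.2))]
  have h2 : ∑ e ∈ X.interedges univ univ, (g e.1 + g e.2) ^ 2 ≤ 4 * D * s := by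
    have hf := sum_interedges_univ_fst_le hD (F := fun v => g v ^ 2) (fun v => sq_nonneg _)
    have hf' := sum_interedges_univ_swap (X := X) (fun e => g e.1 ^ 2)
    calc ∑ e ∈ X.interedges univ univ, (g e.1 + g e.2) ^ 2
        ≤ ∑ e ∈ X.interedges univ univ, (2 * g e.1 ^ 2 + 2 * g e.2 ^ 2) :=
          Finset.sum_le_sum fun e _ => by nlinarith [sq_nonneg (g e.1 - g e.2)]
      _ = 2 * ∑ e ∈ X.interedges univ univ, g e.1 ^ 2
          + 2 * ∑ e ∈ X.interedges univ univ, g e.2 ^ 2 := by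
          rw [Finset.sum_add_distrib, Finset.mul_sum, Finset.mul_sum]
      _ ≤ 4 * D * s := by
          simp only [Prod.fst_swap] at hf'
          rw [hf']
          linarith
  have h3 := Finset.sum_mul_sq_le_sq_mul_sq (X.interedges univ univ)
    (fun e => |g e.1 - g e.2|) (fun e => g e.1 + g e.2)
  simp only [sq_abs] at h3
  have h4 : (c * s) ^ 2 ≤ E * (4 * D * s) :=
    (pow_le_pow_left₀ (by positivity) h1 2).trans (h3.trans (by gcongr))
  rcases hs.eq_or_lt with h0 | h0
  · rw [← h0]; simp; positivity
  · refine le_of_mul_le_mul_right ?_ h0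
    linarith [h4]

theorem exists_median [Nonempty V] (f : V → ℝ) :
    ∃ m, 2 * #{v | m < f v} ≤ Fintype.card V ∧ 2 * #{v | f v < m} ≤ Fintype.card V := by
  let T : Finset V := {v | 2 * #{w | f v < f w} ≤ Fintype.card V}
  have hT : T.Nonempty := by
    obtain ⟨v, hv⟩ := Finite.exists_max f
    refine ⟨v, ?_⟩
    have : ({w | f v < f w} : Finset V) = ∅ := by
      ext w; simpa using hv w
    simp [T, this]
  obtain ⟨a, haT, hmin⟩ := T.exists_min_image f hT
  refine ⟨f a, by simpa [T] using haT, ?_⟩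
  rcases ({v | f v < f a} : Finset V).eq_empty_or_nonempty with h | h
  · simp [h]
  obtain ⟨u, hu, hmax⟩ := Finset.exists_max_image _ f h
  simp only [mem_filter, mem_univ, true_and] at hu hmax
  have huT : u ∉ T := fun h' => absurd (hmin u h') (not_le.2 hu)
  simp only [T, mem_filter, mem_univ, true_and, not_le] at huT
  have hd : Disjoint ({w | f u < f w} : Finset V)
      ({v | f v < f a} : Finset V) := by
    rw [Finset.disjoint_filter]
    intro x _ h1 h2
    exact absurd (hmax x h2) (not_le.2 h1)
  have := Finset.card_le_univ (({w | f u < f w} : Finset V) ∪ ({v | f v < f a} : Finset V))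
  rw [Finset.card_union_of_disjoint hd] at this
  omega

/-- The Poincaré inequality of a graph with an isoperimetric inequality. -/
theorem sum_sum_sub_sq_le [Nonempty V] (hc : 0 < c)
    (hX : ∀ A : Finset V, 2 * #A ≤ Fintype.card V → c * #A ≤ #(X.interedges A Aᶜ))
    (hD : ∀ v, (X.neighborSet v).ncard ≤ D) (f : V → ℝ) :
    ∑ x, ∑ y, (f x - f y) ^ 2 ≤
      16 * D / c ^ 2 * Fintype.card V * ∑ e ∈ X.interedges univ univ, (f e.1 - f e.2) ^ 2 := by
  obtain ⟨m, hm1, hm2⟩ := exists_median f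
  have hp := sq_mul_sum_sq_le_of_small_support hc.le hX hD (fun v => max (f v - m) 0)
    (fun v => le_max_right _ _) (by simpa using hm1)
  have hn := sq_mul_sum_sq_le_of_small_support hc.le hX hD (fun v => max (m - f v) 0)
    (fun v => le_max_right _ _) (by simpa using hm2)
  have hsq : ∀ v, (f v - m) ^ 2 = max (f v - m) 0 ^ 2 + max (m - f v) 0 ^ 2 := fun v => by
    rcases le_total (f v) m with h | h
    · rw [max_eq_right (by linarith), max_eq_left (by linarith)]; ring
    · rw [max_eq_left (by linarith), max_eq_right (by linarith)]; ring
  set E := ∑ e ∈ X.interedges univ univ, (f e.1 - f e.2) ^ 2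
  have hE : ∑ e ∈ X.interedges univ univ, (max (f e.1 - m) 0 - max (f e.2 - m) 0) ^ 2
      + ∑ e ∈ X.interedges univ univ, (max (m - f e.1) 0 - max (m - f e.2) 0) ^ 2 ≤ E := by
    rw [← Finset.sum_add_distrib]
    refine Finset.sum_le_sum fun e _ => ?_
    rcases le_total (f e.1) m with h | h <;> rcases le_total (f e.2) m with h' | h'
    · rw [max_eq_right (by linarith), max_eq_right (by linarith), max_eq_left (by linarith),
        max_eq_left (by linarith)]
      exact le_of_eq (by ring)
    · rw [max_eq_right (by linarith), max_eq_left (by linarith), max_eq_left (by linarith),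
        max_eq_right (by linarith)]
      nlinarith [mul_nonneg (sub_nonneg.2 h) (sub_nonneg.2 h')]
    · rw [max_eq_left (by linarith), max_eq_right (by linarith), max_eq_right (by linarith),
        max_eq_left (by linarith)]
      nlinarith [mul_nonneg (sub_nonneg.2 h) (sub_nonneg.2 h')]
    · rw [max_eq_left (by linarith), max_eq_left (by linarith), max_eq_right (by linarith),
        max_eq_right (by linarith)]
      exact le_of_eq (by ring)
  have hvar : c ^ 2 * ∑ v, (f v - m) ^ 2 ≤ 4 * D * E := by
    rw [Finset.sum_congr rfl fun v _ => hsq v, Finset.sum_add_distrib, mul_add]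
    calc _ ≤ _ := add_le_add hp hn
      _ ≤ _ := by rw [← mul_add]; gcongr
  have hpairs : ∑ x, ∑ y, (f x - f y) ^ 2 ≤ 4 * Fintype.card V * ∑ v, (f v - m) ^ 2 := by
    calc ∑ x, ∑ y, (f x - f y) ^ 2
        ≤ ∑ x, ∑ y, (2 * (f x - m) ^ 2 + 2 * (f y - m) ^ 2) := by
          refine Finset.sum_le_sum fun x _ => Finset.sum_le_sum fun y _ => ?_
          nlinarith [sq_nonneg ((f x - m) + (f y - m))]
      _ = _ := by
          simp only [Finset.sum_add_distrib, ← Finset.mul_sum, Finset.sum_const, card_univ,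
            nsmul_eq_mul]
          ring
  have hvar' : ∑ v, (f v - m) ^ 2 ≤ 4 * D * E / c ^ 2 := by
    rw [le_div_iff₀ (by positivity)]
    linarith
  calc _ ≤ _ := hpairs
    _ ≤ 4 * Fintype.card V * (4 * D * E / c ^ 2) := by gcongr
    _ = _ := by ring

end Poincare

/-! ### Gaussian kernels and concentration -/

section Kernel
open scoped Classical Matrix
open Finset

variable {V : Type*} [Fintype V] {X : SimpleGraph V} {c : ℝ} {D : ℕ}

theorem Matrix.PosSemidef.pow_hadamard {ι : Type*} [Finite ι] {A : Matrix ι ι ℝ}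
    (hA : A.PosSemidef) (k : ℕ) : (Matrix.of fun i j => A i j ^ k).PosSemidef := by
  induction k with
  | zero =>
    have h : (Matrix.of fun i j => A i j ^ 0) = Matrix.gram ℝ (fun _ : ι => (1 : ℝ)) := by
      ext i j
      simp
    exact h ▸ Matrix.posSemidef_gram ℝ _
  | succ k ih =>
    have h : (Matrix.of fun i j => A i j ^ (k + 1)) = (Matrix.of fun i j => A i j ^ k) ⊙ A := by
      ext i j
      simp [pow_succ]
    exact h ▸ ih.hadamard hA

/-- The entrywise exponential preserves positive semidefiniteness: its power series is a sum of
entrywise powers, to which the Schur product theorem applies. -/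
theorem Matrix.PosSemidef.exp_hadamard {ι : Type*} [Fintype ι] {A : Matrix ι ι ℝ}
    (hA : A.PosSemidef) : (Matrix.of fun i j => Real.exp (A i j)).PosSemidef := by
  refine .of_dotProduct_mulVec_nonneg ?_ fun x => ?_
  · ext i j
    have := hA.isHermitian.apply i j
    simp only [star_trivial] at this
    simp [this]
  · have hs : HasSum (fun k : ℕ => star x ⬝ᵥ
        (((k.factorial : ℝ)⁻¹ • Matrix.of fun i j => A i j ^ k) *ᵥ x))
        (star x ⬝ᵥ ((Matrix.of fun i j => Real.exp (A i j)) *ᵥ x)) := by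
      simp only [dotProduct, Matrix.mulVec, Matrix.smul_apply, Matrix.of_apply, smul_eq_mul]
      refine hasSum_sum fun i _ => (hasSum_sum fun j _ => ?_).mul_left _
      refine HasSum.mul_right _ ?_
      have := NormedSpace.expSeries_div_hasSum_exp (A i j)
      rw [← Real.exp_eq_exp_ℝ] at this
      simpa [div_eq_inv_mul] using this
    exact hs.nonneg fun k => ((hA.pow_hadamard k).smul (by positivity)).dotProduct_mulVec_nonneg x

/-- Schoenberg: Gaussian kernels on a Hilbert space are positive semidefinite. A weight `w` is
carried along. -/
theorem posSemidef_mul_gaussian {ι E : Type*} [Fintype ι] [NormedAddCommGroup E]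
    [InnerProductSpace ℝ E] (w : ι → ℝ) (a : ι → E) {t : ℝ} (ht : 0 ≤ t) :
    (Matrix.of fun i j => w i * w j * Real.exp (-t * ‖a i - a j‖ ^ 2)).PosSemidef := by
  have h1 := ((Matrix.posSemidef_gram ℝ a).smul (show (0 : ℝ) ≤ 2 * t by positivity)).exp_hadamard
  have h2 := Matrix.posSemidef_gram ℝ (fun i => w i * Real.exp (-t * ‖a i‖ ^ 2))
  refine (congrArg Matrix.PosSemidef ?_).mpr (h2.hadamard h1)
  ext i j
  simp only [Matrix.of_apply, Matrix.hadamard_apply, Matrix.gram_apply, Matrix.smul_apply,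
    smul_eq_mul, norm_sub_sq_real]
  rw [show -t * (‖a i‖ ^ 2 - 2 * inner ℝ (a i) (a j) + ‖a j‖ ^ 2)
    = -t * ‖a i‖ ^ 2 + -t * ‖a j‖ ^ 2 + 2 * t * inner ℝ (a i) (a j) by ring, Real.exp_add,
    Real.exp_add]
  simp only [RCLike.inner_apply, conj_trivial]
  ring

/-- The Poincaré inequality for the squared distance of a positive semidefinite kernel. -/
theorem Matrix.PosSemidef.sum_sum_sqDist_le [Nonempty V] {M : Matrix V V ℝ} (hM : M.PosSemidef)
    (hc : 0 < c)
    (hX : ∀ A : Finset V, 2 * #A ≤ Fintype.card V → c * #A ≤ #(X.interedges A Aᶜ))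
    (hD : ∀ v, (X.neighborSet v).ncard ≤ D) :
    ∑ x, ∑ y, (M x x + M y y - 2 * M x y) ≤ 16 * D / c ^ 2 * Fintype.card V *
      ∑ e ∈ X.interedges univ univ, (M e.1 e.1 + M e.2 e.2 - 2 * M e.1 e.2) := by
  obtain ⟨B, hB⟩ : ∃ B : Matrix V V ℝ, M = star B * B := by
    open scoped MatrixOrder in
    exact CStarAlgebra.nonneg_iff_eq_star_mul_self.mp hM.nonneg
  have hd : ∀ x y, M x x + M y y - 2 * M x y = ∑ i, (B i x - B i y) ^ 2 := fun x y => by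
    simp only [hB, Matrix.mul_apply, Matrix.star_apply, star_trivial, Finset.mul_sum,
      ← Finset.sum_add_distrib, ← Finset.sum_sub_distrib]
    exact Finset.sum_congr rfl fun i _ => by ring
  simp only [hd]
  calc ∑ x, ∑ y, ∑ i, (B i x - B i y) ^ 2 = ∑ i, ∑ x, ∑ y, (B i x - B i y) ^ 2 := by
        rw [Finset.sum_comm]
        rw [Finset.sum_congr rfl fun y _ => Finset.sum_comm, Finset.sum_comm]
        exact Finset.sum_congr rfl fun i _ => Finset.sum_comm
    _ ≤ ∑ i, 16 * D / c ^ 2 * Fintype.card V *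
          ∑ e ∈ X.interedges univ univ, (B i e.1 - B i e.2) ^ 2 :=
        Finset.sum_le_sum fun i _ => sum_sum_sub_sq_le hc hX hD _
    _ = _ := by rw [← Finset.mul_sum, Finset.sum_comm]

/-- Concentration: a map to a Hilbert space, defined on a definite proportion `A` of the vertices
of an expander and with displacement controlled by `γ`, sends a definite proportion of the
vertices to a ball of radius `L`. Neither constant depends on the graph.

The Gaussian kernel makes the map bounded, so that a cut-off function of the distance to `A`
extends it to all vertices without any control on the growth of `γ`; the Poincaré inequality
applies to the extension. -/
theorem exists_concentration {c : ℝ} (hc : 0 < c) (D : ℕ) (γ : ℕ → ℝ) {α : ℝ} (hα : 0 < α) :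
    ∃ L : ℝ, ∀ {V : Type*} [Fintype V] [Nonempty V] {X : SimpleGraph V} (_ : X.Connected)
      (_ : ∀ A : Finset V, 2 * #A ≤ Fintype.card V → c * #A ≤ #(X.interedges A Aᶜ))
      (_ : ∀ v, (X.neighborSet v).ncard ≤ D)
      {E : Type*} [NormedAddCommGroup E] [InnerProductSpace ℝ E] (A : Finset V) (f : V → E)
      (_ : α * Fintype.card V ≤ #A)
      (_ : ∀ x ∈ A, ∀ y ∈ A, ‖f x - f y‖ ≤ γ (X.dist x y)),
      ∃ x ∈ A, α / 2 * Fintype.card V ≤ #{y ∈ A | ‖f x - f y‖ ≤ L} := by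
  set P : ℝ := 16 * D / c ^ 2 with hP
  have hP0 : 0 ≤ P := by positivity
  -- the energy allowed per edge, such that the Poincaré inequality bounds by `1 / 2` the average
  -- over `A × A` of the squared distance of the kernel `M` below
  set ε : ℝ := α ^ 2 / (2 * (P * D + 1)) with hε
  have hε0 : 0 < ε := by positivity
  obtain ⟨R, hR⟩ := exists_nat_gt (max 1 (2 / ε))
  have hR1 : (1 : ℝ) < R := (le_max_left _ _).trans_lt hR
  have hRε : 1 / (R : ℝ) ≤ ε / 2 := by
    have := (le_max_right _ _).trans_lt hR
    rw [div_lt_iff₀ hε0] at this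
    rw [div_le_iff₀ (by linarith)]
    linarith
  set Γ : ℝ := ∑ i ∈ Finset.range (2 * R + 2), |γ i| with hΓ
  have hγΓ : ∀ i ≤ 2 * R + 1, γ i ≤ Γ := fun i hi =>
    (le_abs_self _).trans (Finset.single_le_sum (f := fun i => |γ i|) (fun _ _ => abs_nonneg _)
      (Finset.mem_range.2 (by omega)))
  set t : ℝ := ε / (4 * (Γ ^ 2 + 1)) with ht
  have ht0 : 0 < t := by positivity
  have htΓ : t * Γ ^ 2 ≤ ε / 4 := by
    rw [ht, div_mul_eq_mul_div, div_le_div_iff₀ (by positivity) (by norm_num)]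
    nlinarith
  -- beyond the distance `√(1 / t)` the Gaussian kernel is at most `exp (-1) < 1 / 2`
  refine ⟨√(1 / t), fun {V} _ _ {X} hconn hX hD {E} _ _ A f hA hf => ?_⟩
  have hV : (0 : ℝ) < Fintype.card V := by exact_mod_cast Fintype.card_pos
  have hA0 : (0 : ℝ) < #A := lt_of_lt_of_le (by positivity) hA
  have hAne : A.Nonempty := Finset.card_pos.1 (by exact_mod_cast hA0)
  -- `p x` is a nearest point of `A`
  choose p hpA hp using fun x => A.exists_min_image (X.dist x) hAne
  have hpx : ∀ x ∈ A, p x = x := fun x hx => by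
    have := hp x x hx
    rw [X.dist_self, Nat.le_zero, hconn.dist_eq_zero_iff] at this
    exact this.symm
  set w : V → ℝ := fun x => max (1 - X.dist x (p x) / R) 0 with hw
  have hw0 : ∀ x, 0 ≤ w x := fun x => le_max_right _ _
  have hw1 : ∀ x, w x ≤ 1 := fun x => max_le (by
    have : (0 : ℝ) ≤ X.dist x (p x) / R := by positivity
    linarith) zero_le_one
  have hwA : ∀ x ∈ A, w x = 1 := fun x hx => by simp [hw, hpx x hx]
  have hwR : ∀ x, w x ≠ 0 → X.dist x (p x) < R := fun x hx => by
    by_contra h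
    push Not at h
    refine hx (max_eq_right ?_)
    rw [sub_nonpos, one_le_div (by linarith)]
    exact_mod_cast h
  set M : Matrix V V ℝ :=
    Matrix.of fun x y => w x * w y * Real.exp (-t * ‖f (p x) - f (p y)‖ ^ 2) with hM
  have hMdist : ∀ x y, M x x + M y y - 2 * M x y = (w x - w y) ^ 2
      + 2 * (w x * w y) * (1 - Real.exp (-t * ‖f (p x) - f (p y)‖ ^ 2)) := fun x y => by
    simp only [hM, Matrix.of_apply, sub_self, norm_zero]
    norm_num
    ring
  have hMnn : ∀ x y, 0 ≤ M x x + M y y - 2 * M x y := fun x y => by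
    rw [hMdist]
    have : Real.exp (-t * ‖f (p x) - f (p y)‖ ^ 2) ≤ 1 := by
      rw [Real.exp_le_one_iff, neg_mul, neg_nonpos]
      positivity
    have := mul_nonneg (mul_nonneg zero_le_two (mul_nonneg (hw0 x) (hw0 y))) (sub_nonneg.2 this)
    positivity
  have hedge : ∀ e ∈ X.interedges univ univ, M e.1 e.1 + M e.2 e.2 - 2 * M e.1 e.2 ≤ ε := by
    rintro ⟨x, y⟩ hxy
    simp only [SimpleGraph.mem_interedges_iff, mem_univ, true_and] at hxy
    have hxy1 : X.dist x y = 1 := SimpleGraph.dist_eq_one_iff_adj.2 hxy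
    have hd1 : X.dist x (p x) ≤ 1 + X.dist y (p y) :=
      (hp x _ (hpA y)).trans (hxy1 ▸ hconn.dist_triangle)
    have hd2 : X.dist y (p y) ≤ 1 + X.dist x (p x) :=
      (hp y _ (hpA x)).trans ((X.dist_comm (u := x) (v := y) ▸ hxy1) ▸ hconn.dist_triangle)
    have hd1' : (X.dist x (p x) : ℝ) ≤ 1 + X.dist y (p y) := by exact_mod_cast hd1
    have hd2' : (X.dist y (p y) : ℝ) ≤ 1 + X.dist x (p x) := by exact_mod_cast hd2
    have hwd : (w x - w y) ^ 2 ≤ ε / 2 := by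
      have h1 : |w x - w y| ≤ 1 / R := by
        refine (abs_max_sub_max_le_abs _ _ _).trans ?_
        rw [sub_sub_sub_cancel_left, ← sub_div, abs_div, Nat.abs_cast]
        gcongr
        exact abs_le.2 ⟨by linarith, by linarith⟩
      have h2 : 1 / (R : ℝ) ≤ 1 := by
        rw [div_le_one (by linarith)]
        exact hR1.le
      rw [← sq_abs]
      nlinarith [abs_nonneg (w x - w y)]
    rw [hMdist]
    rcases eq_or_ne (w x) 0 with h0 | hx
    · rw [h0] at hwd ⊢
      simp only [zero_mul, mul_zero, add_zero]
      linarith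
    rcases eq_or_ne (w y) 0 with h0 | hy
    · rw [h0] at hwd ⊢
      simp only [zero_mul, mul_zero, add_zero]
      linarith
    have hpp : X.dist (p x) (p y) ≤ 2 * R + 1 := by
      have h1 := hconn.dist_triangle (u := p x) (v := x) (w := p y)
      have h2 := hconn.dist_triangle (u := x) (v := y) (w := p y)
      rw [X.dist_comm (u := p x) (v := x)] at h1
      have := hwR x hx
      have := hwR y hy
      omega
    have hs : ‖f (p x) - f (p y)‖ ≤ Γ := (hf _ (hpA x) _ (hpA y)).trans (hγΓ _ hpp)
    have hs2 : t * ‖f (p x) - f (p y)‖ ^ 2 ≤ ε / 4 :=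
      le_trans (by gcongr) htΓ
    have hexp := Real.add_one_le_exp (-t * ‖f (p x) - f (p y)‖ ^ 2)
    have hww : w x * w y ≤ 1 := mul_le_one₀ (hw1 x) (hw0 y) (hw1 y)
    have hww0 : 0 ≤ w x * w y := mul_nonneg (hw0 x) (hw0 y)
    nlinarith
  have hsum : ∑ x ∈ A, ∑ y ∈ A, (M x x + M y y - 2 * M x y) ≤ #A * (#A / 2) := by
    have h1 : ∑ x ∈ A, ∑ y ∈ A, (M x x + M y y - 2 * M x y)
        ≤ ∑ x, ∑ y, (M x x + M y y - 2 * M x y) :=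
      (Finset.sum_le_sum fun x _ => Finset.sum_le_sum_of_subset_of_nonneg A.subset_univ
        fun y _ _ => hMnn x y).trans (Finset.sum_le_sum_of_subset_of_nonneg A.subset_univ
          fun x _ _ => Finset.sum_nonneg fun y _ => hMnn x y)
    have h2 := (posSemidef_mul_gaussian w (fun x => f (p x)) ht0.le).sum_sum_sqDist_le hc hX hD
    have h3 : ∑ e ∈ X.interedges univ univ, (M e.1 e.1 + M e.2 e.2 - 2 * M e.1 e.2)
        ≤ D * (Fintype.card V * ε) := by
      refine (Finset.sum_le_sum hedge).trans ?_
      simpa using sum_interedges_univ_fst_le (F := fun _ => ε) hD fun _ => hε0.le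
    have h4 : P * D * ε ≤ α ^ 2 / 2 := by
      rw [hε, mul_div_assoc', div_le_div_iff₀ (by positivity) (by norm_num)]
      nlinarith [sq_nonneg α]
    calc _ ≤ _ := h1
      _ ≤ _ := h2
      _ ≤ P * Fintype.card V * (D * (Fintype.card V * ε)) := by gcongr
      _ = P * D * ε * (Fintype.card V : ℝ) ^ 2 := by ring
      _ ≤ α ^ 2 / 2 * (Fintype.card V : ℝ) ^ 2 := by gcongr
      _ = (α * Fintype.card V) ^ 2 / 2 := by ring
      _ ≤ (#A : ℝ) ^ 2 / 2 := by gcongr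
      _ = _ := by ring
  obtain ⟨x, hxA, hx⟩ : ∃ x ∈ A, ∑ y ∈ A, (M x x + M y y - 2 * M x y) ≤ #A / 2 := by
    refine Finset.exists_le_of_sum_le hAne (hsum.trans_eq ?_)
    simp
  refine ⟨x, hxA, ?_⟩
  have hfar : ∀ y ∈ A, ¬ ‖f x - f y‖ ≤ √(1 / t) → 1 ≤ M x x + M y y - 2 * M x y := by
    intro y hy h
    rw [hMdist, hwA x hxA, hwA y hy, hpx x hxA, hpx y hy]
    rw [not_le, Real.sqrt_lt' (lt_of_le_of_lt (Real.sqrt_nonneg _) h),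
      div_lt_iff₀ ht0] at h
    have h1 : Real.exp (-t * ‖f x - f y‖ ^ 2) ≤ Real.exp (-1) :=
      Real.exp_le_exp.2 (by linarith)
    have h2 := Real.exp_neg_one_lt_half
    linarith
  have hcount : (#{y ∈ A | ¬ ‖f x - f y‖ ≤ √(1 / t)} : ℝ) ≤ #A / 2 := by
    refine le_trans ?_ hx
    rw [← Finset.sum_filter_add_sum_filter_not A (fun y => ‖f x - f y‖ ≤ √(1 / t))]
    have h1 := Finset.card_nsmul_le_sum {y ∈ A | ¬ ‖f x - f y‖ ≤ √(1 / t)}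
      (fun y => M x x + M y y - 2 * M x y) 1
      fun y hy => hfar y (Finset.mem_filter.1 hy).1 (Finset.mem_filter.1 hy).2
    have h2 : 0 ≤ ∑ y ∈ A with ‖f x - f y‖ ≤ √(1 / t), (M x x + M y y - 2 * M x y) :=
      Finset.sum_nonneg fun y _ => hMnn x y
    rw [nsmul_eq_mul, mul_one] at h1
    linarith
  have hsplit : (#{y ∈ A | ‖f x - f y‖ ≤ √(1 / t)} : ℝ)
      + #{y ∈ A | ¬ ‖f x - f y‖ ≤ √(1 / t)} = #A := by
    exact_mod_cast Finset.card_filter_add_card_filter_not (s := A) _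
  linarith

end Kernel

/-! ### Growth of balls and diameters -/

section Growth
open scoped Classical
open Finset

namespace SimpleGraph

theorem Connected.exists_adj_dist_le {V : Type*} {X : SimpleGraph V} (hX : X.Connected) {x y : V}
    {r : ℕ} (h : X.dist x y ≤ r + 1) (hxy : x ≠ y) : ∃ z, X.Adj z y ∧ X.dist x z ≤ r := by
  obtain ⟨q, hq⟩ := hX.exists_walk_length_eq_dist y x
  cases q with
  | nil => exact absurd rfl hxy
  | cons hadj q =>
    rename_i z
    refine ⟨z, hadj.symm, ?_⟩
    rw [Walk.length_cons, dist_comm] at hq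
    have := X.dist_comm (u := x) (v := z) ▸ X.dist_le q
    omega

theorem Connected.finite_and_ncard_ball_le {V : Type*} {X : SimpleGraph V} (hX : X.Connected)
    {D : ℕ} (hD : ∀ v, (X.neighborSet v).Finite ∧ (X.neighborSet v).ncard ≤ D) (x : V) (r : ℕ) :
    {y | X.dist x y ≤ r}.Finite ∧ {y | X.dist x y ≤ r}.ncard ≤ (D + 1) ^ r := by
  induction r with
  | zero =>
    have : {y | X.dist x y ≤ 0} = {x} := by
      ext y
      simp only [Nat.le_zero, hX.dist_eq_zero_iff, Set.mem_ofPred_eq, Set.mem_singleton_iff, eq_comm]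
    rw [this]
    simp
  | succ r ih =>
    obtain ⟨hfin, hcard⟩ := ih
    set B := hfin.toFinset with hB
    have hBmem : ∀ z, z ∈ B ↔ X.dist x z ≤ r := by simp [hB]
    have hsub : {y | X.dist x y ≤ r + 1}
        ⊆ (B.biUnion fun z => insert z (hD z).1.toFinset : Finset V) := fun y hy => by
      simp only [coe_biUnion, Set.mem_iUnion, mem_coe, Finset.mem_insert, exists_prop]
      rcases eq_or_ne x y with rfl | hxy
      · exact ⟨x, (hBmem x).2 (by simp), Or.inl rfl⟩
      · obtain ⟨z, hzy, hz⟩ := hX.exists_adj_dist_le hy hxy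
        exact ⟨z, (hBmem z).2 hz, Or.inr (by simpa using hzy)⟩
    refine ⟨(Finset.finite_toSet _).subset hsub, ?_⟩
    calc _ ≤ _ := Set.ncard_le_ncard hsub (Finset.finite_toSet _)
      _ = _ := Set.ncard_coe_finset _
      _ ≤ #B * (D + 1) := Finset.card_biUnion_le_card_mul _ _ _ fun z _ =>
        (Finset.card_insert_le _ _).trans (by
          rw [← Set.ncard_eq_toFinset_card _ (hD z).1]
          exact Nat.succ_le_succ (hD z).2)
      _ ≤ (D + 1) ^ (r + 1) := by
        rw [pow_succ]
        gcongr
        rw [hB, ← Set.ncard_eq_toFinset_card _ hfin]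
        exact hcard

variable {V : Type*} [Fintype V] {X : SimpleGraph V} {c : ℝ} {D : ℕ}

/-- In a graph with an isoperimetric inequality, balls grow exponentially until they contain half
of the vertices. -/
theorem Connected.min_le_card_ball (hconn : X.Connected) (hc : 0 ≤ c)
    (hX : ∀ A : Finset V, 2 * #A ≤ Fintype.card V → c * #A ≤ #(X.interedges A Aᶜ))
    (hD : ∀ v, (X.neighborSet v).ncard ≤ D) (x : V) (r : ℕ)
    (hr : 2 * #{y | X.dist x y ≤ r} ≤ Fintype.card V) :
    (1 + c / (D + 1)) ^ (r + 1) ≤ #{y | X.dist x y ≤ r + 1} := by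
  set B : ℕ → Finset V := fun r => {y | X.dist x y ≤ r} with hB
  have step : ∀ s, 2 * #(B s) ≤ Fintype.card V →
      (1 + c / (D + 1)) * #(B s) ≤ #(B (s + 1)) := by
    intro s hs
    have hsub : B s ⊆ B (s + 1) := fun y hy => by
      simp only [hB, mem_filter, mem_univ, true_and] at hy ⊢
      omega
    have h1 : #(X.interedges (B s) (B s)ᶜ) ≤ #(B (s + 1) \ B s) * D := by
      have hmap : ∀ e ∈ X.interedges (B s) (B s)ᶜ, e.2 ∈ B (s + 1) \ B s := by
        rintro ⟨y, z⟩ he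
        simp only [mem_interedges_iff, mem_compl] at he
        refine Finset.mem_sdiff.2 ⟨?_, he.2.1⟩
        have hy := he.1
        simp only [hB, mem_filter, mem_univ, true_and] at hy ⊢
        have := hconn.dist_triangle (u := x) (v := y) (w := z)
        rw [dist_eq_one_iff_adj.2 he.2.2] at this
        omega
      refine (Finset.card_le_mul_card_image_of_maps_to hmap D fun z _ => ?_).trans_eq (mul_comm _ _)
      refine le_trans ?_ (hD z)
      rw [Set.ncard_eq_toFinset_card']
      refine Finset.card_le_card_of_injOn Prod.fst (fun e he => ?_) fun e he e' he' h => ?_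
      · simp only [coe_filter, Set.mem_ofPred_eq, mem_interedges_iff] at he
        simpa [← he.2] using he.1.2.2.symm
      · simp only [coe_filter, Set.mem_ofPred_eq] at he he'
        exact Prod.ext h (he.2.trans he'.2.symm)
    have h2 := hX _ hs
    have h3 : (#(B (s + 1)) : ℝ) = #(B s) + #(B (s + 1) \ B s) := by
      exact_mod_cast (add_comm _ _).trans (Finset.card_sdiff_add_card_eq_card hsub) |>.symm
    have h4 : c * #(B s) ≤ #(B (s + 1) \ B s) * (D + 1) := by
      have : (#(X.interedges (B s) (B s)ᶜ) : ℝ) ≤ #(B (s + 1) \ B s) * D := by exact_mod_cast h1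
      nlinarith [(Nat.cast_nonneg #(B (s + 1) \ B s) : (0 : ℝ) ≤ _)]
    rw [h3, add_mul, one_mul, div_mul_eq_mul_div]
    gcongr
    rw [div_le_iff₀ (by positivity)]
    exact h4
  have hmono : ∀ s ≤ r, 2 * #(B s) ≤ Fintype.card V := fun s hs =>
    le_trans (Nat.mul_le_mul_left 2 (Finset.card_le_card fun y hy => by
      simp only [hB, mem_filter, mem_univ, true_and] at hy ⊢
      omega)) hr
  have hpow : ∀ s ≤ r + 1, (1 + c / (D + 1)) ^ s ≤ #(B s) := by
    intro s
    induction s with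
    | zero =>
      intro _
      have : 1 ≤ #(B 0) := Finset.card_pos.2 ⟨x, by simp [hB]⟩
      simpa using this
    | succ s ih =>
      intro hs
      refine le_trans ?_ (step s (hmono s (by omega)))
      rw [pow_succ']
      gcongr
      exact ih (by omega)
  exact hpow (r + 1) le_rfl

theorem Connected.ediam_ne_top (hconn : X.Connected) : X.ediam ≠ ⊤ := by
  have := hconn.nonempty
  exact connected_iff_ediam_ne_top.1 hconn

/-- Expanders have logarithmic diameter: two balls of more than half of the vertices meet. -/
theorem Connected.diam_mul_log_le (hconn : X.Connected) (hc : 0 < c)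
    (hX : ∀ A : Finset V, 2 * #A ≤ Fintype.card V → c * #A ≤ #(X.interedges A Aᶜ))
    (hD : ∀ v, (X.neighborSet v).ncard ≤ D) :
    X.diam * Real.log (1 + c / (D + 1)) ≤
      2 * (Real.log (Fintype.card V) + Real.log (1 + c / (D + 1))) := by
  have := hconn.nonempty
  have hb : 1 < 1 + c / (D + 1) := by
    have : 0 < c / (D + 1) := by positivity
    linarith
  have hlog := Real.log_pos hb
  set l := Real.log (1 + c / (D + 1)) with hl
  set r := ⌊Real.log (Fintype.card V) / l⌋₊ with hr
  have hbig : ∀ x : V, Fintype.card V < 2 * #{y | X.dist x y ≤ r} := by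
    intro x
    by_contra h
    push Not at h
    have h1 := hconn.min_le_card_ball hc.le hX hD x r h
    have h2 : (#{y | X.dist x y ≤ r + 1} : ℝ) ≤ Fintype.card V := by
      exact_mod_cast Finset.card_le_univ _
    have h3 := Real.log_le_log (by positivity) (h1.trans h2)
    rw [Real.log_pow, ← hl] at h3
    have h4 := Nat.lt_floor_add_one (Real.log (Fintype.card V) / l)
    rw [div_lt_iff₀ hlog] at h4
    push_cast at h3
    linarith
  have hdiam : X.diam ≤ 2 * r := by
    obtain ⟨x, y, hxy⟩ := X.exists_dist_eq_diam
    rw [← hxy]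
    have hnd : ¬ Disjoint ({z | X.dist x z ≤ r} : Finset V)
        ({z | X.dist y z ≤ r} : Finset V) := fun hd => by
      have h1 := Finset.card_le_univ
        (({z | X.dist x z ≤ r} : Finset V) ∪ ({z | X.dist y z ≤ r} : Finset V))
      rw [Finset.card_union_of_disjoint hd] at h1
      have := hbig x
      have := hbig y
      omega
    obtain ⟨z, hz1, hz2⟩ := Finset.not_disjoint_iff.1 hnd
    simp only [mem_filter, mem_univ, true_and] at hz1 hz2
    have := hconn.dist_triangle (u := x) (v := z) (w := y)
    rw [X.dist_comm (u := z) (v := y)] at this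
    omega
  have hr' : (r : ℝ) ≤ Real.log (Fintype.card V) / l :=
    Nat.floor_le (div_nonneg (Real.log_natCast_nonneg _) hlog.le)
  rw [le_div_iff₀ hlog] at hr'
  have : (X.diam : ℝ) ≤ 2 * r := by exact_mod_cast hdiam
  nlinarith

theorem Connected.dist_le_graphSetDiam (hconn : X.Connected) {A : Set V} {x y : V} (hx : x ∈ A)
    (hy : y ∈ A) : X.dist x y ≤ graphSetDiam X A :=
  le_csSup ⟨X.diam, by
    rintro _ ⟨u, -, v, -, rfl⟩
    exact dist_le_diam hconn.ediam_ne_top⟩ ⟨x, hx, y, hy, rfl⟩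

theorem Connected.ncard_le_pow_graphSetDiam (hconn : X.Connected)
    (hD : ∀ v, (X.neighborSet v).ncard ≤ D) {A : Set V} :
    A.ncard ≤ (D + 1) ^ graphSetDiam X A := by
  rcases A.eq_empty_or_nonempty with rfl | ⟨x, hx⟩
  · simp
  have h := hconn.finite_and_ncard_ball_le (fun v => ⟨Set.toFinite _, hD v⟩) x (graphSetDiam X A)
  exact (Set.ncard_le_ncard (fun y hy => hconn.dist_le_graphSetDiam hx hy) h.1).trans h.2

end SimpleGraph

/-- A set containing a definite proportion `β` of the vertices of an expander has diameter
comparable to that of the whole graph: both are of the order of the logarithm of the number of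
vertices. -/
theorem IsExpander.eventually_mul_diam_le_graphSetDiam {V : ℕ → Type*} [∀ n, Fintype (V n)]
    {X : ∀ n, SimpleGraph (V n)} (hX : IsExpander X) {β : ℝ} (hβ : 0 < β) :
    ∃ c : ℝ, 0 < c ∧ ∀ A : ∀ n, Set (V n), (∀ n, β * Fintype.card (V n) ≤ (A n).ncard) →
      ∀ᶠ n in atTop, c * (X n).diam ≤ graphSetDiam (X n) (A n) := by
  obtain ⟨D, hD⟩ := hX.degree_bounded
  obtain ⟨c, hc, hcheeger⟩ := hX.cheeger_bounded_below
  have hc' : (0 : ℝ) < c := by exact_mod_cast hc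
  set l : ℝ := Real.log (1 + c / (D + 1)) with hl
  have hl0 : 0 < l := Real.log_pos (by
    have : (0 : ℝ) < c / (D + 1) := by positivity
    linarith)
  -- a positive upper bound for the logarithm of the growth rate, valid also for `D = 0`
  set m : ℝ := Real.log (D + 1) + 1 with hm
  have hm0 : 0 < m := by
    have := Real.log_nonneg (show (1 : ℝ) ≤ D + 1 by simp)
    linarith
  refine ⟨l / (8 * m), by positivity, fun A hA => ?_⟩
  have hlim : Tendsto (fun n => Real.log (Fintype.card (V n))) atTop atTop :=
    Real.tendsto_log_atTop.comp (tendsto_natCast_atTop_atTop.comp hX.card_tendsto)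
  filter_upwards [hlim.eventually_ge_atTop l, hlim.eventually_ge_atTop (-2 * Real.log β)]
    with n hn1 hn2
  have hconn := hX.connected n
  have := hconn.nonempty
  have hV : (0 : ℝ) < Fintype.card (V n) := by exact_mod_cast Fintype.card_pos
  have h1 := hconn.diam_mul_log_le hc'
    (mul_card_le_card_interedges_of_le_cheegerConstant (hcheeger n)) (hD n)
  have h2 : β * Fintype.card (V n) ≤ ((D : ℝ) + 1) ^ graphSetDiam (X n) (A n) :=
    (hA n).trans (by exact_mod_cast hconn.ncard_le_pow_graphSetDiam (hD n))
  have h3 := Real.log_le_log (by positivity) h2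
  rw [Real.log_mul hβ.ne' hV.ne', Real.log_pow] at h3
  rw [div_mul_eq_mul_div, div_le_iff₀ (by positivity)]
  have h4 : (0 : ℝ) ≤ graphSetDiam (X n) (A n) := Nat.cast_nonneg _
  rw [hm]
  nlinarith

end Growth

/-! ### Word metrics -/

section Cayley
open SimpleGraph

theorem SimpleGraph.Connected.dist_map_le {V W : Type*} {X : SimpleGraph V} {Y : SimpleGraph W}
    (hX : X.Connected) (hY : Y.Connected) {f : V → W}
    (hf : ∀ x y, X.Adj x y → f x = f y ∨ Y.Adj (f x) (f y)) (x y : V) :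
    Y.dist (f x) (f y) ≤ X.dist x y := by
  obtain ⟨q, hq⟩ := hX.exists_walk_length_eq_dist x y
  rw [← hq]
  clear hq
  induction q with
  | nil => simp
  | cons hadj q ih =>
    rw [Walk.length_cons]
    rcases hf _ _ hadj with h | h
    · rw [h]; omega
    · have := (hY.dist_triangle (w := f _)).trans
        (add_le_add (dist_eq_one_iff_adj.2 h).le ih)
      omega

variable {G Q : Type*} [Group G] [Group Q] {S : Set G}

theorem SimpleGraph.reachable_mulCayley_mul {s : G} (hs : s ∈ S) (g : G) :
    (mulCayley S).Reachable g (g * s) := by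
  rcases eq_or_ne g (g * s) with h | h
  · rw [← h]
  · exact (show (mulCayley S).Adj g (g * s) from
      (mulCayley_adj _ _ _).2 ⟨h, Or.inl (by simpa using hs)⟩).reachable

theorem SimpleGraph.connected_mulCayley (hS : Subgroup.closure S = ⊤) :
    (mulCayley S).Connected := by
  have key : ∀ x : G, ∀ g, (mulCayley S).Reachable g (g * x) := fun x => by
    have hx : x ∈ Subgroup.closure S := hS ▸ Subgroup.mem_top x
    induction hx using Subgroup.closure_induction with
    | mem s hs => exact reachable_mulCayley_mul hs
    | one => intro g; rw [mul_one]
    | mul a b _ _ ha hb =>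
      intro g
      rw [← mul_assoc]
      exact (ha g).trans (hb _)
    | inv a _ ha =>
      intro g
      simpa using (ha (g * a⁻¹)).symm
  refine ⟨fun x y => ?_⟩
  simpa using key (x⁻¹ * y) x

theorem wordDist_mul_left (hS : Subgroup.closure S = ⊤) (a g h : G) :
    wordDist S (a * g) (a * h) = wordDist S g h := by
  have hc := connected_mulCayley hS
  have key : ∀ a g h : G, wordDist S (a * g) (a * h) ≤ wordDist S g h := fun a g h =>
    hc.dist_map_le hc (f := fun x => a * x)
      (fun x y hxy => Or.inr (mulCayley_adj_mul_iff_right.2 hxy)) g h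
  refine le_antisymm (key a g h) ?_
  simpa using key a⁻¹ (a * g) (a * h)

theorem closure_image_eq_top_of_surjective {π : G →* Q} (hπ : Function.Surjective π)
    (hS : Subgroup.closure S = ⊤) : Subgroup.closure (π '' S) = ⊤ := by
  rw [← MonoidHom.map_closure, hS, Subgroup.map_top_of_surjective π hπ]

theorem wordDist_map_le {π : G →* Q} (hπ : Function.Surjective π) (hS : Subgroup.closure S = ⊤)
    (g h : G) : wordDist (π '' S) (π g) (π h) ≤ wordDist S g h := by
  refine (connected_mulCayley hS).dist_map_le
    (connected_mulCayley (closure_image_eq_top_of_surjective hπ hS)) (fun x y hxy => ?_) g h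
  rw [mulCayley_adj] at hxy
  rw [or_iff_not_imp_left, mulCayley_adj]
  refine fun hne => ⟨hne, ?_⟩
  rw [← map_inv, ← map_inv, ← map_mul, ← map_mul]
  exact hxy.2.imp (Set.mem_image_of_mem π) (Set.mem_image_of_mem π)

theorem finite_and_ncard_neighborSet_mulCayley_le (hfin : S.Finite) {k : ℕ} (hk : S.ncard ≤ k)
    (g : G) : ((mulCayley S).neighborSet g).Finite ∧
      ((mulCayley S).neighborSet g).ncard ≤ 2 * k := by
  have hsub : (mulCayley S).neighborSet g
      ⊆ (fun s => g * s) '' S ∪ (fun s => g * s⁻¹) '' S := fun y hy => by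
    rw [mem_neighborSet, mulCayley_adj] at hy
    rcases hy.2 with h | h
    · exact Or.inl ⟨_, h, by simp⟩
    · exact Or.inr ⟨_, h, by simp⟩
  have hf := (hfin.image fun s => g * s).union (hfin.image fun s => g * s⁻¹)
  refine ⟨hf.subset hsub, (Set.ncard_le_ncard hsub hf).trans ((Set.ncard_union_le _ _).trans ?_)⟩
  have h1 := Set.ncard_image_le hfin (f := fun s => g * s)
  have h2 := Set.ncard_image_le hfin (f := fun s => g * s⁻¹)
  omega

theorem finite_and_ncard_wordDist_ball_le (hS : Subgroup.closure S = ⊤) (hfin : S.Finite) {k : ℕ}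
    (hk : S.ncard ≤ k) (g : G) (r : ℕ) :
    {h | wordDist S g h ≤ r}.Finite ∧ {h | wordDist S g h ≤ r}.ncard ≤ (2 * k + 1) ^ r :=
  (connected_mulCayley hS).finite_and_ncard_ball_le
    (finite_and_ncard_neighborSet_mulCayley_le hfin hk) g r

end Cayley

/-! ### Large fibers -/

section Fibers
open scoped Classical
open Finset

theorem exists_mul_le_card_fiber {V Y : Type*} {B : Finset V} {h : V → Y} {T : Set Y}
    (hT : T.Finite) {M : ℕ} (hTM : T.ncard ≤ M) (hBT : ∀ x ∈ B, h x ∈ T) (hB : B.Nonempty) :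
    ∃ y, (#B : ℝ) / M ≤ #{x ∈ B | h x = y} := by
  have hmaps : ∀ x ∈ B, h x ∈ hT.toFinset := fun x hx => hT.mem_toFinset.2 (hBT x hx)
  obtain ⟨b, hb⟩ := hB
  have hTne : hT.toFinset.Nonempty := ⟨_, hmaps b hb⟩
  have hTM' : (#hT.toFinset : ℝ) ≤ M := by
    rw [← Set.ncard_eq_toFinset_card _ hT]
    exact_mod_cast hTM
  have hT0 : (0 : ℝ) < #hT.toFinset := by exact_mod_cast hTne.card_pos
  obtain ⟨y, -, hy⟩ := Finset.exists_le_card_fiber_of_nsmul_le_card_of_maps_to hmaps hTne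
    (b := (#B : ℝ) / M) (by
      rw [nsmul_eq_mul, mul_div_assoc', div_le_iff₀ (hT0.trans_le hTM'), mul_comm]
      gcongr)
  exact ⟨y, hy⟩

/-- A Lipschitz map from a definite proportion `A n` of an expander to a space of uniformly bounded
geometry has a fiber of definite proportion, as soon as its image embeds coarsely in a Hilbert
space. The coarse embedding is given by its values `f` at the points of the domain. -/
theorem IsExpander.exists_large_fiber {V : ℕ → Type*} [∀ n, Fintype (V n)]
    {X : ∀ n, SimpleGraph (V n)} (hX : IsExpander X) {Y : ℕ → Type*} (d : ∀ n, Y n → Y n → ℕ)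
    (M : ℕ → ℕ) (hball : ∀ n y r, {y' | d n y y' ≤ r}.Finite ∧ {y' | d n y y' ≤ r}.ncard ≤ M r)
    {α : ℝ} (hα : 0 < α) (A : ∀ n, Finset (V n)) (hA : ∀ n, α * Fintype.card (V n) ≤ #(A n))
    (k : ∀ n, V n → Y n) (K : ℝ)
    (hk : ∀ n, ∀ x ∈ A n, ∀ y ∈ A n, (d n (k n x) (k n y) : ℝ) ≤ K * (X n).dist x y)
    {H : Type*} [NormedAddCommGroup H] [InnerProductSpace ℝ H] (f : ∀ n, V n → H)
    (ρ γ : ℝ≥0 → ℝ≥0) (hρ : Tendsto ρ atTop atTop)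
    (hf : ∀ n, ∀ x ∈ A n, ∀ y ∈ A n, ρ (d n (k n x) (k n y)) ≤ nndist (f n x) (f n y) ∧
      nndist (f n x) (f n y) ≤ γ (d n (k n x) (k n y))) :
    ∃ β : ℝ, 0 < β ∧ ∀ n, ∃ y, β * Fintype.card (V n) ≤ #{x ∈ A n | k n x = y} := by
  obtain ⟨D, hD⟩ := hX.degree_bounded
  obtain ⟨c, hc, hcheeger⟩ := hX.cheeger_bounded_below
  -- `γ` need not be monotone, but only its values at the integers up to `K m` matter
  obtain ⟨L, hL⟩ := exists_concentration (c := c) (by exact_mod_cast hc) D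
    (fun m => ∑ i ∈ Finset.range (⌊K * m⌋₊ + 1), (γ i : ℝ)) hα
  obtain ⟨s, hs⟩ := (hρ.eventually_gt_atTop L.toNNReal).exists_forall_of_atTop
  have hMpos : ∀ n, 0 < Fintype.card (V n) := fun n => by
    have := (hX.connected n).nonempty
    exact Fintype.card_pos
  refine ⟨α / 2 / (M ⌈s⌉₊ + 1), by positivity, fun n => ?_⟩
  have := (hX.connected n).nonempty
  obtain ⟨x, hxA, hx⟩ := hL (hX.connected n)
    (mul_card_le_card_interedges_of_le_cheegerConstant (hcheeger n)) (hD n) (A n) (f n) (hA n)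
    fun x hx y hy => by
      rw [← dist_eq_norm, ← coe_nndist]
      refine (NNReal.coe_le_coe.2 (hf n x hx y hy).2).trans ?_
      refine Finset.single_le_sum (f := fun i : ℕ => (γ i : ℝ)) (fun _ _ => NNReal.coe_nonneg _)
        (Finset.mem_range.2 (Nat.lt_succ_of_le (Nat.le_floor (hk n x hx y hy))))
  set B : Finset (V n) := {y ∈ A n | ‖f n x - f n y‖ ≤ L} with hB
  have hBne : B.Nonempty := Finset.card_pos.1 (by
    have : (0 : ℝ) < Fintype.card (V n) := by exact_mod_cast hMpos n
    have : (0 : ℝ) < #B := lt_of_lt_of_le (by positivity) hx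
    exact_mod_cast this)
  have hBT : ∀ y ∈ B, k n y ∈ {y' | d n (k n x) y' ≤ ⌈s⌉₊} := fun y hy => by
    obtain ⟨hyA, hy⟩ := Finset.mem_filter.1 hy
    by_contra h
    simp only [Set.mem_ofPred_eq, not_le] at h
    have h1 := hs (d n (k n x) (k n y)) ((Nat.le_ceil s).trans (by exact_mod_cast h.le))
    have h2 := h1.trans_le (hf n x hxA y hyA).1
    rw [← dist_eq_norm, ← coe_nndist] at hy
    exact (NNReal.le_toNNReal_of_coe_le hy).not_gt h2
  obtain ⟨y, hy⟩ := exists_mul_le_card_fiber (hball n (k n x) ⌈s⌉₊).1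
    ((hball n (k n x) ⌈s⌉₊).2.trans (Nat.le_succ _)) hBT hBne
  refine ⟨y, ?_⟩
  calc α / 2 / (M ⌈s⌉₊ + 1) * Fintype.card (V n)
      = α / 2 * Fintype.card (V n) / ((M ⌈s⌉₊ + 1 : ℕ) : ℝ) := by push_cast; ring
    _ ≤ #B / ((M ⌈s⌉₊ + 1 : ℕ) : ℝ) := by gcongr
    _ ≤ _ := hy
    _ ≤ _ := by
      exact_mod_cast Finset.card_le_card (Finset.filter_subset_filter _ (Finset.filter_subset _ _))

end Fibers

theorem mainTheorem3
    {N G Q : ℕ → Type*} [∀ n, Group (N n)] [∀ n, Group (G n)] [∀ n, Group (Q n)]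
    (k : ℕ) (S : ∀ n, Finset (G n))
    (hS_card : ∀ n, (S n).card = k)
    (hS_gen : ∀ n, Subgroup.closure (S n : Set (G n)) = ⊤)
    (E : ∀ n, GroupExtension (N n) (G n) (Q n))
    {H₁ : Type*} [NormedAddCommGroup H₁] [InnerProductSpace ℝ H₁] [CompleteSpace H₁]
    (φ : ∀ n, N n → H₁)
    (hφ : IsCoarseEmbeddingSeq
      (fun n a b => (wordDist (S n : Set (G n)) ((E n).inl a) ((E n).inl b) : ℝ≥0)) φ)
    {H₂ : Type*} [NormedAddCommGroup H₂] [InnerProductSpace ℝ H₂] [CompleteSpace H₂]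
    (ψ : ∀ n, Q n → H₂)
    (hψ : IsCoarseEmbeddingSeq
      (fun n a b => (wordDist ((E n).rightHom '' (S n : Set (G n))) a b : ℝ≥0)) ψ)
    (K : ℝ) (hK : 0 < K)
    {V : ℕ → Type*} [∀ n, Fintype (V n)] (X : ∀ n, SimpleGraph (V n)) (hX : IsExpander X)
    (h : ∀ n, V n → G n)
    (hh : ∀ (n : ℕ) (x y : V n),
      (wordDist (S n : Set (G n)) (h n x) (h n y) : ℝ) ≤ K * ((X n).dist x y : ℝ)) :
    ∃ c : ℝ, 0 < c ∧ ∃ y : ∀ n, G n,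
      (∀ n, c * (Fintype.card (V n) : ℝ) ≤ ((h n ⁻¹' {y n}).ncard : ℝ)) ∧
      (∀ᶠ n in atTop, c * ((X n).diam : ℝ) ≤ (graphSetDiam (X n) (h n ⁻¹' {y n}) : ℝ)) := by
  classical
  obtain ⟨ρ₂, γ₂, hρ₂, -, hψ⟩ := hψ
  obtain ⟨ρ₁, γ₁, hρ₁, -, hφ⟩ := hφ
  have hSk : ∀ n, (S n : Set (G n)).ncard ≤ k := fun n => by
    rw [Set.ncard_coe_finset, hS_card]
  have hquot : ∀ n x y, wordDist ((E n).rightHom '' (S n : Set (G n)))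
      ((E n).rightHom x) ((E n).rightHom y) ≤ wordDist (S n : Set (G n)) x y := fun n =>
    wordDist_map_le (E n).rightHom_surjective (hS_gen n)
  -- a definite proportion of the expander lies over one point of the quotient
  obtain ⟨α, hα, hq⟩ := hX.exists_large_fiber
    (fun n => wordDist ((E n).rightHom '' (S n : Set (G n)))) (fun r => (2 * k + 1) ^ r)
    (fun n => finite_and_ncard_wordDist_ball_le
      (closure_image_eq_top_of_surjective (E n).rightHom_surjective (hS_gen n))
      ((S n).finite_toSet.image _)
      ((Set.ncard_image_le (S n).finite_toSet).trans (hSk n)))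
    one_pos (fun _ => Finset.univ) (fun n => by simp)
    (fun n x => (E n).rightHom (h n x)) K
    (fun n x _ y _ => le_trans (by exact_mod_cast hquot n _ _) (hh n x y))
    (fun n x => ψ n ((E n).rightHom (h n x))) ρ₂ γ₂ hρ₂
    (fun n x _ y _ => hψ n _ _)
  choose q hq using hq
  set A : ∀ n, Finset (V n) := fun n => {x | (E n).rightHom (h n x) = q n} with hA
  have hcoset : ∀ n, ∃ g : G n, ∃ ν : V n → N n, ∀ x ∈ A n, h n x = g * (E n).inl (ν x) := by
    intro n
    obtain ⟨g, hg⟩ := (E n).rightHom_surjective (q n)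
    have : ∀ x, ∃ ν : N n, x ∈ A n → h n x = g * (E n).inl ν := fun x => by
      by_cases hx : x ∈ A n
      · have hx' : (E n).rightHom (h n x) = q n := by simpa [hA] using hx
        have hker : g⁻¹ * h n x ∈ (E n).inl.range := by
          rw [(E n).range_inl_eq_ker_rightHom, MonoidHom.mem_ker, map_mul, map_inv, hg, hx',
            inv_mul_cancel]
        obtain ⟨ν, hν⟩ := hker
        exact ⟨ν, fun _ => by rw [hν, mul_inv_cancel_left]⟩
      · exact ⟨1, fun hx' => absurd hx' hx⟩
    choose ν hν using this
    exact ⟨g, ν, hν⟩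
  choose g ν hν using hcoset
  have hdist : ∀ n, ∀ x ∈ A n, ∀ y ∈ A n, wordDist (S n : Set (G n)) (h n x) (h n y)
      = wordDist (S n : Set (G n)) ((E n).inl (ν n x)) ((E n).inl (ν n y)) :=
    fun n x hx y hy => by
      rw [hν n x hx, hν n y hy, wordDist_mul_left (hS_gen n)]
  -- within that fiber, which maps to a coset of `N n`, a definite proportion lies over one point
  obtain ⟨β, hβ, hy⟩ := hX.exists_large_fiber (fun n => wordDist (S n : Set (G n)))
    (fun r => (2 * k + 1) ^ r)
    (fun n => finite_and_ncard_wordDist_ball_le (hS_gen n) (S n).finite_toSet (hSk n))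
    hα A hq h K (fun n x _ y _ => hh n x y) (fun n x => φ n (ν n x)) ρ₁ γ₁ hρ₁
    (fun n x hx y hy => by
      rw [hdist n x hx y hy]
      exact hφ n _ _)
  choose y hy using hy
  have hcard : ∀ n, β * Fintype.card (V n) ≤ ((h n ⁻¹' {y n}).ncard : ℝ) := fun n => by
    refine (hy n).trans ?_
    rw [← Set.ncard_coe_finset]
    exact_mod_cast Set.ncard_le_ncard (fun x hx => (Finset.mem_filter.1 hx).2) (Set.toFinite _)
  obtain ⟨c, hc, hdiam⟩ := hX.eventually_mul_diam_le_graphSetDiam hβ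
  refine ⟨min c β, lt_min hc hβ, y, fun n => le_trans ?_ (hcard n), ?_⟩
  · gcongr
    exact min_le_right _ _
  · filter_upwards [hdiam _ hcard] with n hn
    refine le_trans ?_ hn
    gcongr
    exact min_le_left _ _
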